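/- **Theorem (Semenov-Tian-Shanskii factorization).** Let $k$ be a commutative ring (for instance a field), and let $(\mathfrak g,\vartriangleleft,\mathfrak a)$ be a right Lie module over $k$: $\mathfrak g$ and $\mathfrak a$ are Lie $k$-algebras and $\vartriangleleft:\mathfrak g\otimes\mathfrak a\to\mathfrak g$ is a right action by derivations, that is, $$[x,y]\vartriangleleft a=[x\vartriangleleft a,y]+[x,y\vartriangleleft a],\qquad x\vartriangleleft[a,b]=(x\vartriangleleft a)\vartriangleleft b-(x\vartriangleleft b)\vartriangleleft a .$$ A linear map $\mathbf t:\mathfrak g\to\mathfrak a$ is an $\mathcal O$-Lie operator if $[\mathbf t(x),\mathbf t(y)]=\mathbf t(x\vartriangleleft\mathbf t(y))-\mathbf t(y\vartriangleleft\mathbf t(x))+\mathbf t([x,y])$ for all $x,y\in\mathfrak g$. A pair $\{\mathbf s,\mathbf t\}$ of $\mathcal O$-Lie operators is a matching $\mathcal O$-Lie operator if moreover, for all $x,y\in\mathfrak g$, $$[\mathbf s(x),\mathbf t(y)]=\mathbf s(x\vartriangleleft\mathbf t(y))-\mathbf t(y\vartriangleleft\mathbf s(x)),\qquad [\mathbf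 t(x),\mathbf s(y)]=\mathbf t(x\vartriangleleft\mathbf s(y))-\mathbf s(y\vartriangleleft\mathbf t(x)).$$ Equip the universal enveloping algebras $U(\mathfrak g)$, $U(\mathfrak a)$ with their usual cocommutative Hopf algebra structures (coproduct $\Delta f=f_{(1)}\otimes f_{(2)}$, counit $\varepsilon$, antipode $\mathcal S$), and extend $\vartriangleleft$ to the right action of the algebra $U(\mathfrak a)$ on $U(\mathfrak g)$ for which each $a\in\mathfrak a$ acts by the derivation $x_1\cdots x_n\mapsto\sum_i x_1\cdots(x_i\vartriangleleft a)\cdots x_n$; this makes $(U(\mathfrak g),\vartriangleleft,U(\mathfrak a))$ a right Hopf module. For an $\mathcal O$-Lie operator $\mathbf t$, let $[\mathbf t]:U(\mathfrak g)\to U(\mathfrak a)$ be the unique linear map with $$[\mathbf t](1)=1,\qquad [\mathbf t](h)=\mathbf t(h),\qquad [\mathbf t](Eh)=[\mathbf t](E)\,\mathbf t(h)-[\mathbf t](E\vartriangleleft\mathbf t(h))\qquad(E\in U(\mathfrak g),\ h\in\mathfrak g).$$ An $\mathcal O$-Hopf operator is a coalgebra morphism $T:U(\mathfrak g)\to U(\mathfrak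 a)$ such that $T(e)T(f)=T\big((e\vartriangleleft T(f_{(1)}))f_{(2)}\big)$ for all $e,f$. For linear maps $A,B:U(\mathfrak g)\to U(\mathfrak a)$, let $A\# B$ be the Guin-Oudom product $$(A\#B)(f)=A\Big(f_{(1)}\vartriangleleft\mathcal S\big(B(f_{(2)})_{(1)}\big)\Big)\,B(f_{(2)})_{(2)} .$$ Let $\{\mathbf s,\mathbf t\}$ be a matching $\mathcal O$-Lie operator on $(\mathfrak g,\vartriangleleft,\mathfrak a)$. Then $\mathbf s+\mathbf t$ is an $\mathcal O$-Lie operator, the maps $[\mathbf s]$, $[\mathbf t]$ and $[\mathbf s+\mathbf t]$ are $\mathcal O$-Hopf operators (in particular, coalgebra morphisms), and $$[\mathbf s+\mathbf t]=[\mathbf s]\#[\mathbf t]=[\mathbf t]\#[\mathbf s].$$ -/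

import Mathlib

noncomputable section

open TensorProduct

namespace UniversalEnvelopingAlgebra

section Aux

attribute [local instance 100] LieRing.ofAssociativeRing

variable {R L A : Type*} [CommRing R] [LieRing L] [LieAlgebra R L] [Ring A] [Algebra R A]

/-- The canonical linear map from a Lie algebra to its universal enveloping algebra. -/
def inc (R : Type*) {L : Type*} [CommRing R] [LieRing L] [LieAlgebra R L] :
    L →ₗ[R] UniversalEnvelopingAlgebra R L :=
  (ι R : L →ₗ⁅R⁆ UniversalEnvelopingAlgebra R L)

theorem inc_lie (x y : L) : inc R ⁅x, y⁆ = inc R x * inc R y - inc R y * inc R x := by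
  simp [inc, LieRing.of_associative_ring_bracket]

/-- The algebra morphism on the enveloping algebra that extends a linear map which sends brackets
to commutators. -/
def extend (f : L →ₗ[R] A) (hf : ∀ x y, f ⁅x, y⁆ = f x * f y - f y * f x) :
    UniversalEnvelopingAlgebra R L →ₐ[R] A :=
  lift R
    { f with
      map_lie' := fun {x y} => by
        simpa [LieRing.of_associative_ring_bracket] using hf x y }

@[simp]
theorem extend_inc (f : L →ₗ[R] A) (hf : ∀ x y, f ⁅x, y⁆ = f x * f y - f y * f x) (x : L) :
    extend f hf (inc R x) = f x :=
  lift_ι_apply R _ x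

theorem algHom_ext {f g : UniversalEnvelopingAlgebra R L →ₐ[R] A}
    (h : ∀ x, f (inc R x) = g (inc R x)) : f = g := by
  apply hom_ext
  apply LieHom.ext
  exact h

theorem mem_subalgebra (S : Subalgebra R (UniversalEnvelopingAlgebra R L))
    (h : ∀ x, inc R x ∈ S) (E : UniversalEnvelopingAlgebra R L) : E ∈ S := by
  let f : UniversalEnvelopingAlgebra R L →ₐ[R] S :=
    extend ((inc R).codRestrict (Subalgebra.toSubmodule S) h) fun x y => by
      apply Subtype.ext
      exact inc_lie x y
  have hf : S.val.comp f = AlgHom.id R _ := algHom_ext fun x => by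
    simp [f]; rfl
  have := congrArg (fun g => g E) hf
  simp only [AlgHom.comp_apply, AlgHom.id_apply] at this
  rw [← this]
  exact (f E).2

/-- Induction by multiplication with Lie algebra elements on the right. -/
theorem induction_right {P : UniversalEnvelopingAlgebra R L → Prop} (one : P 1)
    (add : ∀ E F, P E → P F → P (E + F)) (smul : ∀ (r : R) E, P E → P (r • E))
    (mul : ∀ E x, P E → P (E * inc R x)) (E : UniversalEnvelopingAlgebra R L) : P E := by
  let S : Subalgebra R (UniversalEnvelopingAlgebra R L) :=
    { carrier := {E | ∀ F, P F → P (F * E)}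
      mul_mem' := fun {a b} ha hb F hF => by
        rw [← mul_assoc]; exact hb _ (ha _ hF)
      add_mem' := fun {a b} ha hb F hF => by
        rw [mul_add]; exact add _ _ (ha _ hF) (hb _ hF)
      algebraMap_mem' := fun r F hF => by
        rw [← Algebra.commutes, ← Algebra.smul_def]; exact smul _ _ hF }
  have := mem_subalgebra S (fun x F hF => mul F x hF) E 1 one
  rwa [one_mul] at this

/-- Induction by multiplication with Lie algebra elements on the left. -/
theorem induction_left {P : UniversalEnvelopingAlgebra R L → Prop} (one : P 1)
    (add : ∀ E F, P E → P F → P (E + F)) (smul : ∀ (r : R) E, P E → P (r • E))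
    (mul : ∀ x E, P E → P (inc R x * E)) (E : UniversalEnvelopingAlgebra R L) : P E := by
  let S : Subalgebra R (UniversalEnvelopingAlgebra R L) :=
    { carrier := {E | ∀ F, P F → P (E * F)}
      mul_mem' := fun {a b} ha hb F hF => by
        rw [mul_assoc]; exact ha _ (hb _ hF)
      add_mem' := fun {a b} ha hb F hF => by
        rw [add_mul]; exact add _ _ (ha _ hF) (hb _ hF)
      algebraMap_mem' := fun r F hF => by
        rw [← Algebra.smul_def]; exact smul _ _ hF }
  have := mem_subalgebra S (fun x F hF => mul x F hF) E 1 one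
  rwa [mul_one] at this

end Aux

section Hopf

variable (R L : Type*) [CommRing R] [LieRing L] [LieAlgebra R L]

/-- The coproduct, for which the elements of the Lie algebra are primitive. -/
def comulHom : UniversalEnvelopingAlgebra R L →ₐ[R]
    UniversalEnvelopingAlgebra R L ⊗[R] UniversalEnvelopingAlgebra R L :=
  extend ((TensorProduct.mk R _ _).flip 1 ∘ₗ inc R + TensorProduct.mk R _ _ 1 ∘ₗ inc R)
    fun x y => by
      simp only [LinearMap.add_apply, LinearMap.comp_apply, LinearMap.flip_apply,
        TensorProduct.mk_apply, inc_lie, mul_add, add_mul, Algebra.TensorProduct.tmul_mul_tmul,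
        TensorProduct.sub_tmul, TensorProduct.tmul_sub, mul_one, one_mul]
      abel

/-- The counit, which vanishes on the Lie algebra. -/
def counitHom : UniversalEnvelopingAlgebra R L →ₐ[R] R :=
  extend 0 fun x y => by simp

/-- The antipode, the anti-automorphism which is `-1` on the Lie algebra. -/
def antipodeHom : UniversalEnvelopingAlgebra R L →ₐ[R] (UniversalEnvelopingAlgebra R L)ᵐᵒᵖ :=
  extend (-((MulOpposite.opLinearEquiv R).toLinearMap ∘ₗ inc R)) fun x y => by
    simp [inc_lie, ← MulOpposite.op_mul, ← MulOpposite.op_sub, ← MulOpposite.op_neg]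

variable {R L}

@[simp]
theorem comulHom_inc (x : L) :
    comulHom R L (inc R x) = inc R x ⊗ₜ[R] 1 + 1 ⊗ₜ[R] inc R x := by
  simp [comulHom]

@[simp]
theorem counitHom_inc (x : L) : counitHom R L (inc R x) = 0 := by
  simp [counitHom]

@[simp]
theorem antipodeHom_inc (x : L) :
    antipodeHom R L (inc R x) = MulOpposite.op (-inc R x) := by
  simp [antipodeHom]

instance instBialgebra : Bialgebra R (UniversalEnvelopingAlgebra R L) :=
  Bialgebra.ofAlgHom (comulHom R L) (counitHom R L)
    (algHom_ext fun x => by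
      simp [TensorProduct.add_tmul, TensorProduct.tmul_add, Algebra.TensorProduct.one_def,
        add_assoc])
    (algHom_ext fun x => by simp)
    (algHom_ext fun x => by simp)

@[simp]
theorem comul_inc (x : L) :
    Coalgebra.comul (R := R) (inc R x) = inc R x ⊗ₜ[R] 1 + 1 ⊗ₜ[R] inc R x :=
  comulHom_inc x

@[simp]
theorem counit_inc (x : L) : Coalgebra.counit (R := R) (inc R x) = 0 :=
  counitHom_inc x

/-- The antipode as a linear map. -/
def antipodeLin : UniversalEnvelopingAlgebra R L →ₗ[R] UniversalEnvelopingAlgebra R L :=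
  (MulOpposite.opLinearEquiv R).symm.toLinearMap ∘ₗ (antipodeHom R L).toLinearMap

theorem antipodeLin_one : antipodeLin (1 : UniversalEnvelopingAlgebra R L) = 1 := by
  simp [antipodeLin]

theorem antipodeLin_mul (E F : UniversalEnvelopingAlgebra R L) :
    antipodeLin (E * F) = antipodeLin F * antipodeLin E := by
  simp [antipodeLin]

theorem antipodeLin_inc (x : L) : antipodeLin (inc R x) = -inc R x := by
  simp [antipodeLin]

instance instHopfAlgebra : HopfAlgebra R (UniversalEnvelopingAlgebra R L) where
  antipode := antipodeLin
  mul_antipode_rTensor_comul := by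
    ext E
    induction E using induction_left with
    | one => simp [Algebra.TensorProduct.one_def, antipodeLin_one]
    | add E F hE hF => rw [map_add, map_add, hE, hF]
    | smul r E hE => rw [map_smul, map_smul, hE]
    | mul x E hE =>
      have key : ∀ z : UniversalEnvelopingAlgebra R L ⊗[R] UniversalEnvelopingAlgebra R L,
          LinearMap.mul' R _ (antipodeLin.rTensor _
            ((inc R x ⊗ₜ[R] 1 + 1 ⊗ₜ[R] inc R x) * z)) = 0 := by
        intro z
        induction z with
        | zero => simp
        | add a b ha hb => rw [mul_add, map_add, map_add, ha, hb, add_zero]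
        | tmul a b => simp [add_mul, antipodeLin_mul, antipodeLin_inc, mul_assoc]
      simp [Bialgebra.comul_mul, key]
  mul_antipode_lTensor_comul := by
    ext E
    induction E using induction_right with
    | one => simp [Algebra.TensorProduct.one_def, antipodeLin_one]
    | add E F hE hF => rw [map_add, map_add, hE, hF]
    | smul r E hE => rw [map_smul, map_smul, hE]
    | mul E x hE =>
      have key : ∀ z : UniversalEnvelopingAlgebra R L ⊗[R] UniversalEnvelopingAlgebra R L,
          LinearMap.mul' R _ (antipodeLin.lTensor _
            (z * (inc R x ⊗ₜ[R] 1 + 1 ⊗ₜ[R] inc R x))) = 0 := by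
        intro z
        induction z with
        | zero => simp
        | add a b ha hb => rw [add_mul, map_add, map_add, ha, hb, add_zero]
        | tmul a b => simp [mul_add, antipodeLin_mul, antipodeLin_inc, mul_assoc]
      simp [Bialgebra.comul_mul, key]

@[simp]
theorem antipode_inc (x : L) : HopfAlgebra.antipode R (inc R x) = -inc R x :=
  antipodeLin_inc x

theorem antipode_mul (E F : UniversalEnvelopingAlgebra R L) :
    HopfAlgebra.antipode R (E * F) = HopfAlgebra.antipode R F * HopfAlgebra.antipode R E :=
  antipodeLin_mul E F

instance instIsCocomm : Coalgebra.IsCocomm R (UniversalEnvelopingAlgebra R L) where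
  comm_comp_comul := by
    have : (Algebra.TensorProduct.comm R _ _).toAlgHom.comp (comulHom R L) = comulHom R L :=
      algHom_ext fun x => by simp [add_comm]
    exact congrArg AlgHom.toLinearMap this

end Hopf

end UniversalEnvelopingAlgebra

/-- A right Lie module `(𝔤, ◁, 𝔞)`: a right action of the Lie algebra `𝔞` on the Lie algebra `𝔤`
by derivations. Here `act x a` is `x ◁ a`. -/
structure RightLieModule (R 𝔤 𝔞 : Type*) [CommRing R] [LieRing 𝔤] [LieAlgebra R 𝔤]
    [LieRing 𝔞] [LieAlgebra R 𝔞] where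
  act : 𝔤 →ₗ[R] 𝔞 →ₗ[R] 𝔤
  lie_act : ∀ x y a, act ⁅x, y⁆ a = ⁅act x a, y⁆ + ⁅x, act y a⁆
  act_lie : ∀ x a b, act x ⁅a, b⁆ = act (act x a) b - act (act x b) a

/-- A right Hopf module `(H, ◁, K)`: cocommutative Hopf algebras `H` and `K` and a right action of
the algebra `K` on `H`, compatible with the product, the unit, the coproduct, the counit and the
antipode of `H`. Here `act h k` is `h ◁ k`. -/
structure RightHopfModule (R H K : Type*) [CommRing R] [Ring H] [HopfAlgebra R H]
    [Coalgebra.IsCocomm R H] [Ring K] [HopfAlgebra R K] [Coalgebra.IsCocomm R K] where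
  act : H →ₗ[R] K →ₗ[R] H
  act_one : ∀ h, act h 1 = h
  act_mul : ∀ h k l, act h (k * l) = act (act h k) l
  one_act : ∀ k, act 1 k = algebraMap R H (Coalgebra.counit k)
  /-- `(h h') ◁ k = (h ◁ k₁) (h' ◁ k₂)` -/
  mul_act : ∀ h h' k, act (h * h') k =
    LinearMap.mul' R H (TensorProduct.map (act h) (act h') (Coalgebra.comul k))
  counit_act : ∀ h k, Coalgebra.counit (R := R) (act h k) =
    Coalgebra.counit (R := R) h * Coalgebra.counit (R := R) k
  /-- `Δ (h ◁ k) = (h₁ ◁ k₁) ⊗ (h₂ ◁ k₂)` -/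
  comul_act : ∀ h k, Coalgebra.comul (R := R) (act h k) =
    TensorProduct.map₂ act act (Coalgebra.comul h) (Coalgebra.comul k)
  antipode_act : ∀ h k, HopfAlgebra.antipode R (act h k) = act (HopfAlgebra.antipode R h) k

namespace RightHopfModule

variable {R H K : Type*} [CommRing R] [Ring H] [HopfAlgebra R H] [Coalgebra.IsCocomm R H]
  [Ring K] [HopfAlgebra R K] [Coalgebra.IsCocomm R K] (N : RightHopfModule R H K)

/-- The product `e ⋆_T f = (e ◁ T f₁) f₂` on `H` attached to a linear map `T : H → K`. -/
def star (T : H →ₗ[R] K) (e f : H) : H :=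
  LinearMap.mul' R H (TensorProduct.map (N.act e ∘ₗ T) LinearMap.id (Coalgebra.comul f))

/-- An `𝒪`-Hopf operator: a coalgebra morphism `T : H → K` with
`T e * T f = T ((e ◁ T f₁) f₂)`. -/
structure IsOHopfOperator (T : H →ₗ[R] K) : Prop where
  counit_comp : Coalgebra.counit ∘ₗ T = Coalgebra.counit
  map_comp_comul : TensorProduct.map T T ∘ₗ Coalgebra.comul = Coalgebra.comul ∘ₗ T
  mul : ∀ e f, T e * T f = T (N.star T e f)

/-- The product `(A # B) f = A (f₁ ◁ S_K ((B f₂)₁)) (B f₂)₂` on linear maps from `H` to `K`. On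
coalgebra morphisms it is the product of the Guin–Oudom group. -/
def hash (A B : H →ₗ[R] K) : H →ₗ[R] K :=
  LinearMap.mul' R K ∘ₗ
    TensorProduct.map
      (A ∘ₗ TensorProduct.lift N.act ∘ₗ (HopfAlgebra.antipode R).lTensor H) LinearMap.id ∘ₗ
    (TensorProduct.assoc R H K K).symm.toLinearMap ∘ₗ
    (Coalgebra.comul ∘ₗ B).lTensor H ∘ₗ
    Coalgebra.comul

end RightHopfModule

namespace RightLieModule

local notation "𝒰" => UniversalEnvelopingAlgebra

open UniversalEnvelopingAlgebra

variable {R 𝔤 𝔞 : Type*} [CommRing R] [LieRing 𝔤] [LieAlgebra R 𝔤]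
  [LieRing 𝔞] [LieAlgebra R 𝔞] (M : RightLieModule R 𝔤 𝔞)

/-- An `𝒪`-Lie operator on `(𝔤, ◁, 𝔞)`. -/
def IsOLieOperator (t : 𝔤 →ₗ[R] 𝔞) : Prop :=
  ∀ x y, ⁅t x, t y⁆ = t (M.act x (t y)) - t (M.act y (t x)) + t ⁅x, y⁆

/-- A matching `𝒪`-Lie operator on `(𝔤, ◁, 𝔞)`, indexed by `Ω`. -/
structure IsMatchingOLieOperator {Ω : Type*} (t : Ω → 𝔤 →ₗ[R] 𝔞) : Prop where
  isOLieOperator : ∀ w, M.IsOLieOperator (t w)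
  matching : ∀ w w', w ≠ w' → ∀ x y,
    ⁅t w x, t w' y⁆ = t w (M.act x (t w' y)) - t w' (M.act y (t w x))

/-- Auxiliary algebra morphism `X ↦ X + ε (X ◁ a)` into the dual numbers over `U(𝔤)`. -/
def derHom (a : 𝔞) : 𝒰 R 𝔤 →ₐ[R] DualNumber (𝒰 R 𝔤) :=
  extend ((TrivSqZeroExt.inlAlgHom R (𝒰 R 𝔤) (𝒰 R 𝔤)).toLinearMap ∘ₗ inc R +
    (TrivSqZeroExt.inrHom (𝒰 R 𝔤) (𝒰 R 𝔤)).restrictScalars R ∘ₗ inc R ∘ₗ M.act.flip a)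
    fun x y => by
      ext
      · simp [inc_lie]
      · simp [inc_lie, M.lie_act]
        abel

theorem fst_derHom (a : 𝔞) (X : 𝒰 R 𝔤) : (M.derHom a X).fst = X := by
  have : (TrivSqZeroExt.fstHom R (𝒰 R 𝔤) (𝒰 R 𝔤)).comp (M.derHom a) = AlgHom.id R _ :=
    algHom_ext fun x => by simp [derHom]
  exact congrArg (fun f => f X) this

/-- The derivation of `U(𝔤)` extending `x ↦ x ◁ a`, that is,
`x₁ ⋯ xₙ ↦ ∑ᵢ x₁ ⋯ (xᵢ ◁ a) ⋯ xₙ`. -/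
def der (a : 𝔞) : 𝒰 R 𝔤 →ₗ[R] 𝒰 R 𝔤 :=
  (TrivSqZeroExt.sndHom (𝒰 R 𝔤) (𝒰 R 𝔤)).restrictScalars R ∘ₗ (M.derHom a).toLinearMap

@[simp]
theorem der_inc (a : 𝔞) (x : 𝔤) : M.der a (inc R x) = inc R (M.act x a) := by
  simp [der, derHom]

theorem der_mul (a : 𝔞) (X Y : 𝒰 R 𝔤) : M.der a (X * Y) = M.der a X * Y + X * M.der a Y := by
  simp [der, fst_derHom, add_comm]

@[simp]
theorem der_one (a : 𝔞) : M.der a 1 = 0 := by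
  simp [der]

theorem der_add (a b : 𝔞) (X : 𝒰 R 𝔤) : M.der (a + b) X = M.der a X + M.der b X := by
  induction X using induction_right with
  | one => simp
  | add E F hE hF => simp only [map_add, hE, hF]; abel
  | smul r E hE => simp only [map_smul, hE, smul_add]
  | mul E x hE => simp only [der_mul, hE, der_inc, map_add, mul_add, add_mul]; abel

theorem der_smul (r : R) (a : 𝔞) (X : 𝒰 R 𝔤) : M.der (r • a) X = r • M.der a X := by
  induction X using induction_right with
  | one => simp
  | add E F hE hF => simp only [map_add, hE, hF, smul_add]
  | smul r E hE => simp only [map_smul, hE]; rw [smul_comm]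
  | mul E x hE => simp [der_mul, hE]

theorem der_lie (a b : 𝔞) (X : 𝒰 R 𝔤) :
    M.der ⁅a, b⁆ X = M.der b (M.der a X) - M.der a (M.der b X) := by
  induction X using induction_right with
  | one => simp
  | add E F hE hF => simp only [map_add, hE, hF]; abel
  | smul r E hE => simp only [map_smul, hE, smul_sub]
  | mul E x hE =>
    simp only [der_mul, hE, der_inc, M.act_lie, map_sub, map_add]
    noncomm_ring

/-- The algebra morphism from `U(𝔞)` to the opposite of `End (U(𝔤))` which extends
`a ↦ (· ◁ a)`. -/
def actHom : 𝒰 R 𝔞 →ₐ[R] (Module.End R (𝒰 R 𝔤))ᵐᵒᵖ :=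
  extend
    { toFun := fun a => MulOpposite.op (M.der a)
      map_add' := fun a b => by
        rw [← MulOpposite.op_add]; congr 1; ext X; exact M.der_add a b X
      map_smul' := fun r a => by
        rw [RingHom.id_apply, ← MulOpposite.op_smul]; congr 1; ext X; exact M.der_smul r a X }
    fun a b => by
      simp only [LinearMap.coe_mk, AddHom.coe_mk, ← MulOpposite.op_mul, ← MulOpposite.op_sub]
      congr 1
      ext X
      exact M.der_lie a b X

/-- The right action of `U(𝔞)` on `U(𝔤)`. -/
def envelopeAct : 𝒰 R 𝔤 →ₗ[R] 𝒰 R 𝔞 →ₗ[R] 𝒰 R 𝔤 :=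
  ((MulOpposite.opLinearEquiv R).symm.toLinearMap ∘ₗ M.actHom.toLinearMap).flip

theorem envelopeAct_one (X : 𝒰 R 𝔤) : M.envelopeAct X 1 = X := by
  simp [envelopeAct]

theorem envelopeAct_mul (X : 𝒰 R 𝔤) (A B : 𝒰 R 𝔞) :
    M.envelopeAct X (A * B) = M.envelopeAct (M.envelopeAct X A) B := by
  simp [envelopeAct]

@[simp]
theorem envelopeAct_inc (X : 𝒰 R 𝔤) (a : 𝔞) : M.envelopeAct X (inc R a) = M.der a X := by
  simp [envelopeAct, actHom]


theorem counit_der (a : 𝔞) (X : 𝒰 R 𝔤) : Coalgebra.counit (R := R) (M.der a X) = 0 := by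
  induction X using induction_right with
  | one => simp
  | add E F hE hF => simp [hE, hF]
  | smul r E hE => simp [hE]
  | mul E x hE => simp [der_mul, hE]

theorem antipode_der (a : 𝔞) (X : 𝒰 R 𝔤) :
    HopfAlgebra.antipode R (M.der a X) = M.der a (HopfAlgebra.antipode R X) := by
  induction X using induction_right with
  | one => simp
  | add E F hE hF => simp only [map_add, hE, hF]
  | smul r E hE => simp only [map_smul, hE]
  | mul E x hE =>
    simp only [der_mul, antipode_mul, map_add, hE, der_inc, antipode_inc, map_neg]
    abel

theorem comul_der (a : 𝔞) (X : 𝒰 R 𝔤) :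
    Coalgebra.comul (R := R) (M.der a X) =
      (M.der a).rTensor _ (Coalgebra.comul X) + (M.der a).lTensor _ (Coalgebra.comul X) := by
  induction X using induction_right with
  | one => simp [Algebra.TensorProduct.one_def]
  | add E F hE hF => simp only [map_add, hE, hF]; abel
  | smul r E hE => simp only [map_smul, hE, smul_add]
  | mul E x hE =>
    simp only [der_mul, map_add, Bialgebra.comul_mul, hE, der_inc, comul_inc]
    generalize (Coalgebra.comul E : 𝒰 R 𝔤 ⊗[R] 𝒰 R 𝔤) = z
    induction z with
    | zero => simp
    | add z w hz hw =>
      have := congrArg₂ (· + ·) hz hw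
      simp only [map_add, add_mul] at this ⊢
      convert this using 1 <;> abel
    | tmul p q =>
      simp only [mul_add, add_mul, map_add, LinearMap.rTensor_tmul, LinearMap.lTensor_tmul,
        Algebra.TensorProduct.tmul_mul_tmul, der_mul, der_inc, mul_one, TensorProduct.add_tmul,
        TensorProduct.tmul_add]
      abel

/-- The universal envelope `(U(𝔤), ◁, U(𝔞))` of the right Lie module `(𝔤, ◁, 𝔞)`. -/
def envelope : RightHopfModule R (𝒰 R 𝔤) (𝒰 R 𝔞) where
  act := M.envelopeAct
  act_one := M.envelopeAct_one
  act_mul := M.envelopeAct_mul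
  one_act A := by
    induction A using induction_right with
    | one => simp [envelopeAct_one]
    | add E F hE hF => simp only [map_add, hE, hF]
    | smul r E hE => rw [map_smul, hE, map_smul, smul_eq_mul, map_mul, Algebra.smul_def]
    | mul E a hE =>
      rw [envelopeAct_mul, hE, Algebra.algebraMap_eq_smul_one]
      simp
  mul_act X Y A := by
    induction A using induction_right with
    | one => simp [envelopeAct_one, Algebra.TensorProduct.one_def]
    | add E F hE hF => simp only [map_add, hE, hF]
    | smul r E hE => simp only [map_smul, hE]
    | mul E a hE =>
      rw [envelopeAct_mul, hE, Bialgebra.comul_mul, envelopeAct_inc, comul_inc]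
      generalize (Coalgebra.comul E : 𝒰 R 𝔞 ⊗[R] 𝒰 R 𝔞) = z
      induction z with
      | zero => simp
      | add z w hz hw => simp only [map_add, add_mul, hz, hw]
      | tmul p q => simp [mul_add, der_mul, envelopeAct_mul]
  counit_act X A := by
    induction A using induction_right with
    | one => simp [envelopeAct_one]
    | add E F hE hF => simp only [map_add, hE, hF, mul_add]
    | smul r E hE => simp only [map_smul, hE, smul_eq_mul]; ring
    | mul E a hE => simp [envelopeAct_mul, counit_der]
  comul_act X A := by
    induction A using induction_right with
    | one =>
      simp only [envelopeAct_one, Bialgebra.comul_one, Algebra.TensorProduct.one_def]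
      generalize (Coalgebra.comul X : 𝒰 R 𝔤 ⊗[R] 𝒰 R 𝔤) = z
      induction z with
      | zero => simp
      | add z w hz hw => rw [map_add, LinearMap.add_apply, ← hz, ← hw]
      | tmul p q => simp [envelopeAct_one]
    | add E F hE hF => simp only [map_add, hE, hF]
    | smul r E hE => simp only [map_smul, hE]
    | mul E a hE =>
      rw [envelopeAct_mul, envelopeAct_inc, comul_der, hE, Bialgebra.comul_mul, comul_inc]
      generalize (Coalgebra.comul E : 𝒰 R 𝔞 ⊗[R] 𝒰 R 𝔞) = z
      generalize (Coalgebra.comul X : 𝒰 R 𝔤 ⊗[R] 𝒰 R 𝔤) = w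
      induction z with
      | zero => simp
      | add z z' hz hz' => 
        simp only [map_add, add_mul, ← hz, ← hz']
        abel
      | tmul p q =>
        induction w with
        | zero => simp
        | add w w' hw hw' =>
          simp only [map_add, LinearMap.add_apply, ← hw, ← hw']
          abel
        | tmul u v => simp [mul_add, envelopeAct_mul]
  antipode_act X A := by
    induction A using induction_right with
    | one => simp [envelopeAct_one]
    | add E F hE hF => simp only [map_add, hE, hF]
    | smul r E hE => simp only [map_smul, hE]
    | mul E a hE => simp [envelopeAct_mul, antipode_der, hE]

/-- The Guin–Oudom recursion with initial values `t`. -/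
structure IsGuinOudom (t : 𝔤 →ₗ[R] 𝔞) (T : 𝒰 R 𝔤 →ₗ[R] 𝒰 R 𝔞) : Prop where
  map_one : T 1 = 1
  map_inc : ∀ h, T (inc R h) = inc R (t h)
  map_mul_inc : ∀ E h, T (E * inc R h) =
    T E * inc R (t h) - T (M.envelope.act E (inc R (t h)))

section Existence

variable (t : 𝔤 →ₗ[R] 𝔞)

/-- Auxiliary linear map `A ↦ t (h ◁ A)` with values in `U(𝔞)`. -/
def orbit : 𝔤 →ₗ[R] 𝒰 R 𝔞 →ₗ[R] 𝒰 R 𝔞 :=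
  let φ : 𝒰 R 𝔞 →ₐ[R] (Module.End R 𝔤)ᵐᵒᵖ :=
    extend ((MulOpposite.opLinearEquiv R).toLinearMap ∘ₗ M.act.flip) fun a b => by
      simp only [LinearMap.comp_apply, LinearEquiv.coe_coe, MulOpposite.coe_opLinearEquiv,
        ← MulOpposite.op_mul, ← MulOpposite.op_sub]
      congr 1
      ext x
      exact M.act_lie x a b
  (((MulOpposite.opLinearEquiv R).symm.toLinearMap ∘ₗ φ.toLinearMap).flip).compr₂
    (inc R ∘ₗ t)

theorem orbit_one (h : 𝔤) : M.orbit t h 1 = inc R (t h) := by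
  simp [orbit]

theorem orbit_mul (h : 𝔤) (b : 𝔞) (A : 𝒰 R 𝔞) :
    M.orbit t h (inc R b * A) = M.orbit t (M.act h b) A := by
  simp [orbit]

/-- Auxiliary action of `𝔤` on linear endomorphisms of `U(𝔞)`, which turns the family of maps
`A ↦ T (E ◁ A)` into a right module over `U(𝔤)`. -/
def rho (h : 𝔤) (ψ : Module.End R (𝒰 R 𝔞)) : Module.End R (𝒰 R 𝔞) :=
  (LinearMap.mul' R _ ∘ₗ TensorProduct.map ψ (M.orbit t h) -
    ψ ∘ₗ LinearMap.mul' R _ ∘ₗ TensorProduct.map LinearMap.id (M.orbit t h)) ∘ₗ Coalgebra.comul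

theorem rho_one (h : 𝔤) (ψ : Module.End R (𝒰 R 𝔞)) :
    M.rho t h ψ 1 = ψ 1 * inc R (t h) - ψ (inc R (t h)) := by
  simp [rho, Algebra.TensorProduct.one_def, orbit_one]

/-- Precomposition with the left multiplication by `b`. -/
def shift (b : 𝔞) (ψ : Module.End R (𝒰 R 𝔞)) : Module.End R (𝒰 R 𝔞) :=
  ψ ∘ₗ LinearMap.mulLeft R (inc R b)

theorem shift_apply (b : 𝔞) (ψ : Module.End R (𝒰 R 𝔞)) (A : 𝒰 R 𝔞) :
    shift b ψ A = ψ (inc R b * A) := rfl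

theorem shift_rho (h : 𝔤) (b : 𝔞) (ψ : Module.End R (𝒰 R 𝔞)) :
    shift b (M.rho t h ψ) = M.rho t (M.act h b) ψ + M.rho t h (shift b ψ) := by
  ext A
  rw [shift_apply]
  simp only [rho, LinearMap.add_apply, LinearMap.comp_apply, Bialgebra.comul_mul, comul_inc]
  generalize (Coalgebra.comul A : 𝒰 R 𝔞 ⊗[R] 𝒰 R 𝔞) = z
  induction z with
  | zero => simp
  | add z w hz hw =>
    rw [mul_add, map_add, map_add, map_add, hz, hw]
    abel
  | tmul p q =>
    simp [add_mul, shift_apply, orbit_mul, mul_assoc]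
    abel

theorem rho_add_left (x y : 𝔤) (ψ : Module.End R (𝒰 R 𝔞)) :
    M.rho t (x + y) ψ = M.rho t x ψ + M.rho t y ψ := by
  ext A
  simp only [rho, map_add, TensorProduct.map_add_right, LinearMap.add_apply, LinearMap.comp_apply,
    LinearMap.sub_apply]
  abel

theorem rho_smul_left (r : R) (x : 𝔤) (ψ : Module.End R (𝒰 R 𝔞)) :
    M.rho t (r • x) ψ = r • M.rho t x ψ := by
  ext A
  simp only [rho, map_smul, TensorProduct.map_smul_right, LinearMap.smul_apply,
    LinearMap.comp_apply, LinearMap.sub_apply, smul_sub]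

theorem rho_add (x : 𝔤) (ψ χ : Module.End R (𝒰 R 𝔞)) :
    M.rho t x (ψ + χ) = M.rho t x ψ + M.rho t x χ := by
  ext A
  simp only [rho, TensorProduct.map_add_left, LinearMap.add_apply, LinearMap.comp_apply,
    LinearMap.sub_apply, map_add]
  abel

theorem rho_smul (r : R) (x : 𝔤) (ψ : Module.End R (𝒰 R 𝔞)) :
    M.rho t x (r • ψ) = r • M.rho t x ψ := by
  ext A
  simp only [rho, TensorProduct.map_smul_left, LinearMap.smul_apply,
    LinearMap.comp_apply, LinearMap.sub_apply, smul_sub, map_smul]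

variable {M t}

theorem rho_lie (ht : M.IsOLieOperator t) (x y : 𝔤) (ψ : Module.End R (𝒰 R 𝔞)) :
    M.rho t ⁅x, y⁆ ψ = M.rho t y (M.rho t x ψ) - M.rho t x (M.rho t y ψ) := by
  ext A
  induction A using induction_left generalizing x y ψ with
  | one =>
    have hx : ∀ x y : 𝔤, M.rho t x ψ (inc R (t y)) =
        ψ 1 * inc R (t (M.act x (t y))) - ψ (inc R (t (M.act x (t y)))) +
          (ψ (inc R (t y)) * inc R (t x) - ψ (inc R (t y) * inc R (t x))) := by
      intro x y
      have := congrArg (fun f => f 1) (M.shift_rho t x (t y) ψ)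
      simpa [shift_apply, rho_one] using this
    have h1 : t ⁅x, y⁆ = ⁅t x, t y⁆ - t (M.act x (t y)) + t (M.act y (t x)) := by
      rw [ht x y]; abel
    simp only [LinearMap.sub_apply, rho_one, hx, h1, map_sub, map_add, inc_lie]
    noncomm_ring
  | add E F hE hF => simp only [map_add, hE, hF]
  | smul r E hE => simp only [map_smul, hE]
  | mul b E hE =>
    have key : ∀ x y : 𝔤, M.rho t y (M.rho t x ψ) (inc R b * E) =
        M.rho t (M.act y b) (M.rho t x ψ) E + M.rho t y (M.rho t (M.act x b) ψ) E +
          M.rho t y (M.rho t x (shift b ψ)) E := by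
      intro x y
      rw [← shift_apply, shift_rho, shift_rho, rho_add]
      simp only [LinearMap.add_apply]
      abel
    rw [← shift_apply, shift_rho, M.lie_act, rho_add_left]
    simp only [LinearMap.add_apply, LinearMap.sub_apply, hE, key]
    abel

theorem exists_isGuinOudom (ht : M.IsOLieOperator t) : ∃ T, M.IsGuinOudom t T := by
  let f : 𝔤 →ₗ[R] (Module.End R (Module.End R (𝒰 R 𝔞)))ᵐᵒᵖ :=
    { toFun := fun h => MulOpposite.op
        { toFun := M.rho t h, map_add' := M.rho_add t h, map_smul' := fun r => M.rho_smul t r h }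
      map_add' := fun x y => by
        rw [← MulOpposite.op_add]; congr 1; ext1 ψ; exact M.rho_add_left t x y ψ
      map_smul' := fun r x => by
        rw [RingHom.id_apply, ← MulOpposite.op_smul]; congr 1; ext1 ψ
        exact M.rho_smul_left t r x ψ }
  let φ : 𝒰 R 𝔤 →ₐ[R] (Module.End R (Module.End R (𝒰 R 𝔞)))ᵐᵒᵖ :=
    extend (A := (Module.End R (Module.End R (𝒰 R 𝔞)))ᵐᵒᵖ) f fun x y => by
      apply MulOpposite.unop_injective
      ext1 ψ
      exact rho_lie ht x y ψ
  let e : Module.End R (𝒰 R 𝔞) := Algebra.linearMap R _ ∘ₗ Coalgebra.counit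
  let G : 𝒰 R 𝔤 →ₗ[R] Module.End R (𝒰 R 𝔞) :=
    LinearMap.applyₗ e ∘ₗ (MulOpposite.opLinearEquiv R).symm.toLinearMap ∘ₗ φ.toLinearMap
  have G_one : G 1 = e := by simp [G]
  have G_mul : ∀ E h, G (E * inc R h) = M.rho t h (G E) := by
    intro E h
    simp [G, φ, f]
  have G_shift : ∀ E (a : 𝔞), shift a (G E) = G (M.der a E) := by
    intro E a
    induction E using induction_right with
    | one =>
      ext A
      simp [shift_apply, G_one, e]
    | add E F hE hF =>
      rw [map_add, map_add, map_add, ← hE, ← hF]; rfl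
    | smul r E hE => rw [map_smul, map_smul, map_smul, ← hE]; rfl
    | mul E x hE =>
      rw [G_mul, shift_rho, hE, der_mul, map_add, G_mul, der_inc, G_mul, add_comm]
  have G_mul' : ∀ E h, G (E * inc R h) 1 = G E 1 * inc R (t h) - G (M.der (t h) E) 1 := by
    intro E h
    rw [G_mul, rho_one, ← G_shift, shift_apply, mul_one]
  refine ⟨LinearMap.applyₗ 1 ∘ₗ G, ?_, ?_, ?_⟩
  · simp [G_one, e]
  · intro h
    have := G_mul' 1 h
    simpa [G_one, e] using this
  · intro E h
    simpa [envelope] using G_mul' E h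

variable (M) in
theorem exists_act_inc (x : 𝔤) (A : 𝒰 R 𝔞) : ∃ y, M.envelope.act (inc R x) A = inc R y := by
  induction A using induction_right with
  | one => exact ⟨x, M.envelope.act_one _⟩
  | add E F hE hF =>
    obtain ⟨y, hy⟩ := hE
    obtain ⟨z, hz⟩ := hF
    exact ⟨y + z, by rw [map_add, hy, hz, map_add]⟩
  | smul r E hE =>
    obtain ⟨y, hy⟩ := hE
    exact ⟨r • y, by rw [map_smul, hy, map_smul]⟩
  | mul E a hE =>
    obtain ⟨y, hy⟩ := hE
    exact ⟨M.act y a, by rw [M.envelope.act_mul, hy]; simp [envelope]⟩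

theorem IsGuinOudom.unique {T T' : 𝒰 R 𝔤 →ₗ[R] 𝒰 R 𝔞} (hT : M.IsGuinOudom t T)
    (hT' : M.IsGuinOudom t T') : T = T' := by
  have h : ∀ E A, T (M.envelope.act E A) = T' (M.envelope.act E A) := by
    intro E
    induction E using induction_right with
    | one =>
      intro A
      rw [M.envelope.one_act, Algebra.algebraMap_eq_smul_one, map_smul, map_smul, hT.map_one,
        hT'.map_one]
    | add E F hE hF => intro A; simp only [map_add, LinearMap.add_apply, hE, hF]
    | smul r E hE => intro A; simp only [map_smul, LinearMap.smul_apply, hE]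
    | mul E x hE =>
      intro A
      rw [M.envelope.mul_act]
      generalize (Coalgebra.comul A : 𝒰 R 𝔞 ⊗[R] 𝒰 R 𝔞) = z
      induction z with
      | zero => simp
      | add z w hz hw => simp only [map_add, hz, hw]
      | tmul p q =>
        obtain ⟨y, hy⟩ := M.exists_act_inc x q
        rw [TensorProduct.map_tmul, LinearMap.mul'_apply, hy, hT.map_mul_inc, hT'.map_mul_inc,
          ← M.envelope.act_mul, hE, hE]
  ext E
  simpa [M.envelope.act_one] using h E 1

theorem existsUnique_isGuinOudom (ht : M.IsOLieOperator t) : ∃! T, M.IsGuinOudom t T := by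
  obtain ⟨T, hT⟩ := exists_isGuinOudom ht
  exact ⟨T, hT, fun T' hT' => hT'.unique hT⟩

end Existence

/-- The extension `[t] : U(𝔤) → U(𝔞)` of an `𝒪`-Lie operator `t`, the unique linear map that
satisfies the Guin–Oudom recursion with initial values `t`. -/
def guinOudom {t : 𝔤 →ₗ[R] 𝔞} (ht : M.IsOLieOperator t) : 𝒰 R 𝔤 →ₗ[R] 𝒰 R 𝔞 :=
  (existsUnique_isGuinOudom ht).choose

theorem isGuinOudom_guinOudom {t : 𝔤 →ₗ[R] 𝔞} (ht : M.IsOLieOperator t) :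
    M.IsGuinOudom t (M.guinOudom ht) :=
  (existsUnique_isGuinOudom ht).choose_spec.1

end RightLieModule

end

/-! Since `IsGuinOudom.unique` makes the recursion determine the map, it suffices to show that S # T
satisfies the recursion for s + t, where S = [s] and T = [t]. The other order follows by exchanging
s and t, because the second matching relation is the first one with s and t exchanged.

Write ∗ for convolution, 𝒮 for the antipode, and put τ(f) = f₁ ◁ 𝒮(T f₂) and σ_h(f) = S(h ◁ 𝒮(T f)).
As T is a coalgebra morphism, S # T = (S ∘ τ) ∗ T. Right multiplication by the primitive element h
is a derivation for ∗, and τ(f h) = τ(f₁)(h ◁ 𝒮(T f₂)) - τ(f ◁ t(h)). The factor h ◁ 𝒮(T f₂) stays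
in 𝔤, so the recursion for S applies to the product and gives S τ(f h) = ((S ∘ τ) ∗ σ_h)(f) -
S(τ(f₁) ◁ σ_h(f₂)) - S τ(f ◁ t(h)).

The matching relation enters through `convolve_shadow`: (σ_h ∗ T)(f) = T(f) s(h) - T(f ◁ s(h)). It
turns ((S ∘ τ) ∗ σ_h) ∗ T into right multiplication by s(h) minus a correction. Its image under 𝒮
turns τ(f₁) ◁ σ_h(f₂) into τ(f ◁ s(h)). The remaining terms combine because each a in 𝔞 acts by a
coderivation.

Identities for a single [t], including the 𝒪-Hopf property, are proved by comparing recursions with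
`induction_der`: the recursion for E h involves E ◁ t(h), so the hypothesis must cover the whole
𝔞-orbit of E. -/

noncomputable section

open TensorProduct

/-! ### Convolution of linear maps along a bilinear map -/

namespace LinearMap

variable {R C X Y Z : Type*} [CommRing R] [AddCommGroup C] [Module R C] [Coalgebra R C]
  [AddCommGroup X] [Module R X] [AddCommGroup Y] [Module R Y] [AddCommGroup Z] [Module R Z]

/-- The convolution `c ↦ μ (φ c₁) (ψ c₂)` of linear maps along a bilinear map `μ`. -/
def convolve (μ : X →ₗ[R] Y →ₗ[R] Z) (φ : C →ₗ[R] X) (ψ : C →ₗ[R] Y) : C →ₗ[R] Z :=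
  TensorProduct.lift μ ∘ₗ TensorProduct.map φ ψ ∘ₗ Coalgebra.comul

/-- Reduces an identity of convolutions to pure tensors, so that no coproduct has to be expanded.
The intermediate modules may differ on the two sides, which lets a factor move between μ, φ and ψ.
-/
theorem convolve_congr {X' Y' : Type*} [AddCommGroup X'] [Module R X'] [AddCommGroup Y']
    [Module R Y'] {μ : X →ₗ[R] Y →ₗ[R] Z} {φ : C →ₗ[R] X} {ψ : C →ₗ[R] Y}
    {μ' : X' →ₗ[R] Y' →ₗ[R] Z} {φ' : C →ₗ[R] X'} {ψ' : C →ₗ[R] Y'}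
    (h : ∀ a b, μ (φ a) (ψ b) = μ' (φ' a) (ψ' b)) : convolve μ φ ψ = convolve μ' φ' ψ' := by
  have : TensorProduct.lift μ ∘ₗ TensorProduct.map φ ψ =
      TensorProduct.lift μ' ∘ₗ TensorProduct.map φ' ψ' :=
    TensorProduct.ext' fun a b => by simpa using h a b
  unfold convolve
  rw [← LinearMap.comp_assoc, this, LinearMap.comp_assoc]

theorem convolve_eq_sub {X' Y' X'' Y'' : Type*} [AddCommGroup X'] [Module R X'] [AddCommGroup Y']
    [Module R Y'] [AddCommGroup X''] [Module R X''] [AddCommGroup Y''] [Module R Y'']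
    {μ : X →ₗ[R] Y →ₗ[R] Z} {φ : C →ₗ[R] X} {ψ : C →ₗ[R] Y}
    {μ' : X' →ₗ[R] Y' →ₗ[R] Z} {φ' : C →ₗ[R] X'} {ψ' : C →ₗ[R] Y'}
    {μ'' : X'' →ₗ[R] Y'' →ₗ[R] Z} {φ'' : C →ₗ[R] X''} {ψ'' : C →ₗ[R] Y''}
    (h : ∀ a b, μ (φ a) (ψ b) = μ' (φ' a) (ψ' b) - μ'' (φ'' a) (ψ'' b)) :
    convolve μ φ ψ = convolve μ' φ' ψ' - convolve μ'' φ'' ψ'' := by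
  have : TensorProduct.lift μ ∘ₗ TensorProduct.map φ ψ =
      TensorProduct.lift μ' ∘ₗ TensorProduct.map φ' ψ' -
        TensorProduct.lift μ'' ∘ₗ TensorProduct.map φ'' ψ'' :=
    TensorProduct.ext' fun a b => by simpa using h a b
  unfold convolve
  rw [← LinearMap.comp_assoc, this, LinearMap.sub_comp, LinearMap.comp_assoc,
    LinearMap.comp_assoc]

theorem comp_convolve {W : Type*} [AddCommGroup W] [Module R W] (f : Z →ₗ[R] W)
    (μ : X →ₗ[R] Y →ₗ[R] Z) (φ : C →ₗ[R] X) (ψ : C →ₗ[R] Y) :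
    f ∘ₗ convolve μ φ ψ = convolve (μ.compr₂ f) φ ψ := by
  unfold convolve
  rw [← LinearMap.comp_assoc, ← TensorProduct.lift_compr₂]

theorem convolve_add_left (μ : X →ₗ[R] Y →ₗ[R] Z) (φ φ' : C →ₗ[R] X) (ψ : C →ₗ[R] Y) :
    convolve μ (φ + φ') ψ = convolve μ φ ψ + convolve μ φ' ψ := by
  simp [convolve, TensorProduct.map_add_left, LinearMap.add_comp, LinearMap.comp_add]

theorem convolve_add_right (μ : X →ₗ[R] Y →ₗ[R] Z) (φ : C →ₗ[R] X) (ψ ψ' : C →ₗ[R] Y) :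
    convolve μ φ (ψ + ψ') = convolve μ φ ψ + convolve μ φ ψ' := by
  simp [convolve, TensorProduct.map_add_right, LinearMap.add_comp, LinearMap.comp_add]

theorem convolve_neg_left (μ : X →ₗ[R] Y →ₗ[R] Z) (φ : C →ₗ[R] X) (ψ : C →ₗ[R] Y) :
    convolve μ (-φ) ψ = -convolve μ φ ψ :=
  eq_neg_of_add_eq_zero_left <| by
    rw [← convolve_add_left, neg_add_cancel]; simp [convolve, TensorProduct.map_zero_left]

theorem convolve_neg_right (μ : X →ₗ[R] Y →ₗ[R] Z) (φ : C →ₗ[R] X) (ψ : C →ₗ[R] Y) :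
    convolve μ φ (-ψ) = -convolve μ φ ψ :=
  eq_neg_of_add_eq_zero_left <| by
    rw [← convolve_add_right, neg_add_cancel]; simp [convolve, TensorProduct.map_zero_right]

theorem convolve_sub_left (μ : X →ₗ[R] Y →ₗ[R] Z) (φ φ' : C →ₗ[R] X) (ψ : C →ₗ[R] Y) :
    convolve μ (φ - φ') ψ = convolve μ φ ψ - convolve μ φ' ψ := by
  rw [sub_eq_add_neg, convolve_add_left, convolve_neg_left, sub_eq_add_neg]

theorem convolve_sub_right (μ : X →ₗ[R] Y →ₗ[R] Z) (φ : C →ₗ[R] X) (ψ ψ' : C →ₗ[R] Y) :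
    convolve μ φ (ψ - ψ') = convolve μ φ ψ - convolve μ φ ψ' := by
  rw [sub_eq_add_neg, convolve_add_right, convolve_neg_right, sub_eq_add_neg]

theorem convolve_flip [Coalgebra.IsCocomm R C] (μ : X →ₗ[R] Y →ₗ[R] Z) (φ : C →ₗ[R] X) (ψ : C →ₗ[R] Y) :
    convolve μ.flip ψ φ = convolve μ φ ψ := by
  have : TensorProduct.lift μ.flip ∘ₗ TensorProduct.map ψ φ =
      (TensorProduct.lift μ ∘ₗ TensorProduct.map φ ψ) ∘ₗ
        (TensorProduct.comm R C C).toLinearMap :=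
    TensorProduct.ext' fun a b => by simp
  unfold convolve
  rw [← LinearMap.comp_assoc, this, LinearMap.comp_assoc, Coalgebra.IsCocomm.comm_comp_comul,
    LinearMap.comp_assoc]

/-- Coassociativity. -/
theorem convolve_assoc {W V V' : Type*} [AddCommGroup W] [Module R W] [AddCommGroup V]
    [Module R V] [AddCommGroup V'] [Module R V'] {μ : V →ₗ[R] Z →ₗ[R] W}
    {ν : X →ₗ[R] Y →ₗ[R] V} {μ' : X →ₗ[R] V' →ₗ[R] W} {ν' : Y →ₗ[R] Z →ₗ[R] V'}
    (h : ∀ x y z, μ (ν x y) z = μ' x (ν' y z))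
    (φ : C →ₗ[R] X) (ψ : C →ₗ[R] Y) (χ : C →ₗ[R] Z) :
    convolve μ (convolve ν φ ψ) χ = convolve μ' φ (convolve ν' ψ χ) := by
  have hl : convolve μ (convolve ν φ ψ) χ = TensorProduct.lift μ ∘ₗ
      TensorProduct.map (TensorProduct.lift ν ∘ₗ TensorProduct.map φ ψ) χ ∘ₗ
        (Coalgebra.comul.rTensor C) ∘ₗ Coalgebra.comul := by
    rw [LinearMap.rTensor, ← LinearMap.comp_assoc _ _ (TensorProduct.map _ χ), ← TensorProduct.map_comp]
    rfl
  have hr : convolve μ' φ (convolve ν' ψ χ) = TensorProduct.lift μ' ∘ₗ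
      TensorProduct.map φ (TensorProduct.lift ν' ∘ₗ TensorProduct.map ψ χ) ∘ₗ
        (Coalgebra.comul.lTensor C) ∘ₗ Coalgebra.comul := by
    rw [LinearMap.lTensor, ← LinearMap.comp_assoc _ _ (TensorProduct.map φ _), ← TensorProduct.map_comp]
    rfl
  rw [hl, hr, ← Coalgebra.coassoc]
  simp only [← LinearMap.comp_assoc]
  congr 2
  refine TensorProduct.ext_threefold fun a b c => ?_
  simp [h]

end LinearMap

/-! ### Antipode and primitive elements in the enveloping algebra -/

namespace UniversalEnvelopingAlgebra

variable {R L : Type*} [CommRing R] [LieRing L] [LieAlgebra R L]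

/-- Both sides reverse products and agree on primitive elements. No flip of the tensor factors is
needed, in keeping with cocommutativity. -/
theorem comul_antipode (E : UniversalEnvelopingAlgebra R L) :
    Coalgebra.comul (R := R) (HopfAlgebra.antipode R E) =
      TensorProduct.map (HopfAlgebra.antipode R) (HopfAlgebra.antipode R) (Coalgebra.comul E) := by
  induction E using induction_right with
  | one => simp [Algebra.TensorProduct.one_def]
  | add E F hE hF => simp only [map_add, hE, hF]
  | smul r E hE => simp only [map_smul, hE]
  | mul E x hE =>
    rw [antipode_mul, Bialgebra.comul_mul, Bialgebra.comul_mul, hE, antipode_inc, map_neg,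
      comul_inc]
    generalize (Coalgebra.comul E : UniversalEnvelopingAlgebra R L ⊗[R] _) = z
    induction z with
    | zero => simp
    | add z w hz hw => rw [map_add, mul_add, hz, hw, add_mul, map_add]
    | tmul p q =>
      simp [mul_add, add_mul, antipode_mul, TensorProduct.neg_tmul, TensorProduct.tmul_neg]
      abel

/-- The Leibniz rule expresses that h is primitive. -/
theorem convolve_mul_inc {X Y Z : Type*} [AddCommGroup X] [Module R X] [AddCommGroup Y]
    [Module R Y] [AddCommGroup Z] [Module R Z] (μ : X →ₗ[R] Y →ₗ[R] Z)
    (φ : UniversalEnvelopingAlgebra R L →ₗ[R] X) (ψ : UniversalEnvelopingAlgebra R L →ₗ[R] Y)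
    (h : L) :
    LinearMap.convolve μ φ ψ ∘ₗ LinearMap.mulRight R (inc R h) =
      LinearMap.convolve μ (φ ∘ₗ LinearMap.mulRight R (inc R h)) ψ +
        LinearMap.convolve μ φ (ψ ∘ₗ LinearMap.mulRight R (inc R h)) := by
  ext E
  simp only [LinearMap.convolve, LinearMap.comp_apply, LinearMap.mulRight_apply,
    Bialgebra.comul_mul, comul_inc, LinearMap.add_apply]
  generalize (Coalgebra.comul E : UniversalEnvelopingAlgebra R L ⊗[R] _) = z
  induction z with
  | zero => simp
  | add z w hz hw => simp only [map_add, add_mul] at hz hw ⊢; rw [hz, hw]; abel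
  | tmul p q => simp [mul_add]

end UniversalEnvelopingAlgebra

/-! ### Coderivations and induction along the action -/

namespace RightLieModule

open UniversalEnvelopingAlgebra LinearMap

variable {R 𝔤 𝔞 : Type*} [CommRing R] [LieRing 𝔤] [LieAlgebra R 𝔤]
  [LieRing 𝔞] [LieAlgebra R 𝔞] {M : RightLieModule R 𝔤 𝔞}

/-- The Leibniz rule expresses that the derivation induced by a is also a coderivation. -/
theorem convolve_der {X Y Z : Type*} [AddCommGroup X] [Module R X] [AddCommGroup Y]
    [Module R Y] [AddCommGroup Z] [Module R Z] (μ : X →ₗ[R] Y →ₗ[R] Z)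
    (φ : UniversalEnvelopingAlgebra R 𝔤 →ₗ[R] X) (ψ : UniversalEnvelopingAlgebra R 𝔤 →ₗ[R] Y)
    (a : 𝔞) :
    convolve μ φ ψ ∘ₗ M.der a =
      convolve μ (φ ∘ₗ M.der a) ψ + convolve μ φ (ψ ∘ₗ M.der a) := by
  ext E
  simp only [convolve, LinearMap.comp_apply, comul_der, LinearMap.add_apply]
  generalize (Coalgebra.comul E : UniversalEnvelopingAlgebra R 𝔤 ⊗[R] _) = z
  induction z with
  | zero => simp
  | add z w hz hw => simp only [map_add] at hz hw ⊢; rw [add_add_add_comm, hz, hw]; abel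
  | tmul p q => simp

@[simp]
theorem envelope_act_inc (E : UniversalEnvelopingAlgebra R 𝔤) (a : 𝔞) :
    M.envelope.act E (inc R a) = M.der a E :=
  M.envelopeAct_inc E a

variable (M) in
/-- Induction on `U(𝔤)` by multiplication with elements of `𝔤` on the right, with the hypothesis
available for all derivatives along `𝔞`. -/
theorem induction_der (p : Submodule R (UniversalEnvelopingAlgebra R 𝔤)) (one : 1 ∈ p)
    (mul : ∀ E h, E ∈ p → (∀ a, M.der a E ∈ p) → E * inc R h ∈ p)
    (E : UniversalEnvelopingAlgebra R 𝔤) : E ∈ p := by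
  -- Strengthening to the whole orbit E ◁ U(𝔞) makes the derivatives of E available in the product
  -- step.
  suffices h : ∀ A, M.envelope.act E A ∈ p by simpa [M.envelope.act_one] using h 1
  induction E using induction_right with
  | one =>
    intro A
    rw [M.envelope.one_act, Algebra.algebraMap_eq_smul_one]
    exact p.smul_mem _ one
  | add E F hE hF => intro A; rw [map_add]; exact p.add_mem (hE A) (hF A)
  | smul r E hE => intro A; rw [map_smul]; exact p.smul_mem _ (hE A)
  | mul E x hE =>
    intro A
    rw [M.envelope.mul_act]
    generalize (Coalgebra.comul A : UniversalEnvelopingAlgebra R 𝔞 ⊗[R] _) = z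
    induction z with
    | zero => simp
    | add z w hz hw => simp only [map_add]; exact p.add_mem hz hw
    | tmul k l =>
      -- (E x) ◁ A is a sum of products (E ◁ k)(x ◁ l), and x ◁ l is again in 𝔤, so each summand has
      -- the shape required by `mul`.
      obtain ⟨y, hy⟩ := M.exists_act_inc x l
      rw [TensorProduct.map_tmul, LinearMap.mul'_apply, hy]
      refine mul _ _ (hE k) fun a => ?_
      rw [← envelope_act_inc, ← M.envelope.act_mul]
      exact hE _

/-! ### The extension of an 𝒪-Lie operator is an 𝒪-Hopf operator -/

namespace IsGuinOudom

variable {s t : 𝔤 →ₗ[R] 𝔞}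
  {S T : UniversalEnvelopingAlgebra R 𝔤 →ₗ[R] UniversalEnvelopingAlgebra R 𝔞}

theorem map_mul_inc' (hT : M.IsGuinOudom t T) (E : UniversalEnvelopingAlgebra R 𝔤) (h : 𝔤) :
    T (E * inc R h) = T E * inc R (t h) - T (M.der (t h) E) := by
  rw [hT.map_mul_inc, envelope_act_inc]

theorem comp_mulRight (hT : M.IsGuinOudom t T) (h : 𝔤) :
    T ∘ₗ LinearMap.mulRight R (inc R h) =
      LinearMap.mulRight R (inc R (t h)) ∘ₗ T - T ∘ₗ M.der (t h) :=
  LinearMap.ext fun E => hT.map_mul_inc' E h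

theorem counit_comp (hT : M.IsGuinOudom t T) :
    Coalgebra.counit (R := R) ∘ₗ T = Coalgebra.counit := by
  ext E
  refine M.induction_der (LinearMap.eqLocus (Coalgebra.counit (R := R) ∘ₗ T) Coalgebra.counit)
    (by simp [LinearMap.mem_eqLocus, hT.map_one]) (fun E h hE hD => ?_) E
  have hD := hD (t h)
  simp only [LinearMap.mem_eqLocus, LinearMap.comp_apply, counit_der] at hE hD ⊢
  rw [hT.map_mul_inc', map_sub, hD, Bialgebra.counit_mul, Bialgebra.counit_mul]
  simp

/-- Both sides obey the same recursion: h and t(h) are primitive, and the action of t(h) is a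
coderivation. -/
theorem map_comp_comul (hT : M.IsGuinOudom t T) :
    TensorProduct.map T T ∘ₗ Coalgebra.comul = Coalgebra.comul ∘ₗ T := by
  ext E
  refine M.induction_der (LinearMap.eqLocus (TensorProduct.map T T ∘ₗ Coalgebra.comul)
    (Coalgebra.comul ∘ₗ T))
    (by simp [LinearMap.mem_eqLocus, hT.map_one, Algebra.TensorProduct.one_def])
    (fun E h hE hD => ?_) E
  have hD := hD (t h)
  simp only [LinearMap.mem_eqLocus, LinearMap.comp_apply, comul_der] at hE hD ⊢
  rw [hT.map_mul_inc', map_sub, ← hD, Bialgebra.comul_mul, Bialgebra.comul_mul, ← hE, comul_inc,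
    comul_inc]
  generalize (Coalgebra.comul E : UniversalEnvelopingAlgebra R 𝔤 ⊗[R] _) = z
  induction z with
  | zero => simp
  | add z w hz hw => simp only [map_add, add_mul] at hz hw ⊢; rw [hz, hw]; abel
  | tmul p q =>
    simp [mul_add, hT.map_mul_inc', TensorProduct.sub_tmul, TensorProduct.tmul_sub]
    abel

/-- After applying T, the middle term cancels the correction in the recursion for T((e ⋆ f) h). What
remains is the recursion for T(e) T(f h), which gives the 𝒪-Hopf identity. -/
theorem star_mul_inc (hT : M.IsGuinOudom t T) (e f : UniversalEnvelopingAlgebra R 𝔤) (h : 𝔤) :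
    M.envelope.star T e (f * inc R h) = M.envelope.star T e f * inc R h +
      M.der (t h) (M.envelope.star T e f) - M.envelope.star T e (M.der (t h) f) := by
  simp only [RightHopfModule.star, Bialgebra.comul_mul, comul_inc, comul_der]
  generalize (Coalgebra.comul f : UniversalEnvelopingAlgebra R 𝔤 ⊗[R] _) = z
  induction z with
  | zero => simp
  | add z w hz hw => simp only [map_add, add_mul] at hz hw ⊢; rw [hz, hw]; abel
  | tmul p q =>
    simp [mul_add, sub_mul, hT.map_mul_inc', der_mul, M.envelope.act_mul, mul_assoc]
    abel

theorem isOHopfOperator (hT : M.IsGuinOudom t T) : M.envelope.IsOHopfOperator T where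
  counit_comp := hT.counit_comp
  map_comp_comul := hT.map_comp_comul
  mul e f := by
    refine M.induction_der (LinearMap.eqLocus (LinearMap.mulLeft R (T e) ∘ₗ T)
      (T ∘ₗ LinearMap.mul' R _ ∘ₗ TensorProduct.map (M.envelope.act e ∘ₗ T) LinearMap.id ∘ₗ
        Coalgebra.comul)) ?_ (fun E h hE hD => ?_) f
    · simp [LinearMap.mem_eqLocus, hT.map_one, Algebra.TensorProduct.one_def, M.envelope.act_one]
    · replace hE : T e * T E = T (M.envelope.star T e E) := hE
      replace hD : T e * T (M.der (t h) E) = T (M.envelope.star T e (M.der (t h) E)) := hD (t h)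
      change T e * T (E * inc R h) = T (M.envelope.star T e (E * inc R h))
      rw [hT.star_mul_inc, hT.map_mul_inc', mul_sub, ← mul_assoc, hE, hD, map_sub, map_add,
        hT.map_mul_inc']
      abel

end IsGuinOudom

/-- The two matching relations supply exactly the mixed terms in the expansion of the identity for s
+ t. -/
theorem IsMatchingOLieOperator.add {s t : 𝔤 →ₗ[R] 𝔞} (h : M.IsMatchingOLieOperator ![s, t]) :
    M.IsOLieOperator (s + t) := by
  intro x y
  have hs : M.IsOLieOperator s := h.isOLieOperator 0
  have ht : M.IsOLieOperator t := h.isOLieOperator 1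
  have h₁ := h.matching 0 1 (by decide) x y
  have h₂ := h.matching 1 0 (by decide) x y
  simp only [Matrix.cons_val_zero, Matrix.cons_val_one] at h₁ h₂
  simp only [LinearMap.add_apply, add_lie, lie_add, map_add, hs x y, ht x y, h₁, h₂]
  abel

/-! ### The twist and the commutation relation -/

section Twist

variable (M) (S T : UniversalEnvelopingAlgebra R 𝔤 →ₗ[R] UniversalEnvelopingAlgebra R 𝔞)

/-- The map `f ↦ 𝒮 (T f)`. -/
def anti : UniversalEnvelopingAlgebra R 𝔤 →ₗ[R] UniversalEnvelopingAlgebra R 𝔞 :=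
  HopfAlgebra.antipode R ∘ₗ T

@[simp]
theorem anti_apply (E : UniversalEnvelopingAlgebra R 𝔤) :
    anti T E = HopfAlgebra.antipode R (T E) := rfl

/-- The map `f ↦ S (h ◁ 𝒮 (T f))`. -/
def shadow (h : 𝔤) : UniversalEnvelopingAlgebra R 𝔤 →ₗ[R] UniversalEnvelopingAlgebra R 𝔞 :=
  S ∘ₗ M.envelope.act (inc R h) ∘ₗ anti T

@[simp]
theorem shadow_apply (h : 𝔤) (E : UniversalEnvelopingAlgebra R 𝔤) :
    M.shadow S T h E = S (M.envelope.act (inc R h) (HopfAlgebra.antipode R (T E))) := rfl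

/-- The map `f ↦ f₁ ◁ 𝒮 (T f₂)`. -/
def twist : UniversalEnvelopingAlgebra R 𝔤 →ₗ[R] UniversalEnvelopingAlgebra R 𝔤 :=
  convolve M.envelope.act LinearMap.id (anti T)

end Twist

namespace IsGuinOudom

variable {s t : 𝔤 →ₗ[R] 𝔞}
  {S T : UniversalEnvelopingAlgebra R 𝔤 →ₗ[R] UniversalEnvelopingAlgebra R 𝔞}

theorem antipode_comp_mulRight (hT : M.IsGuinOudom t T) (h : 𝔤) :
    (anti T) ∘ₗ LinearMap.mulRight R (inc R h) =
      -(LinearMap.mulLeft R (inc R (t h)) ∘ₗ anti T) - (anti T) ∘ₗ M.der (t h) := by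
  ext E
  simp [hT.map_mul_inc', antipode_mul]

/-- The antipode reverses T(f) t(x), so t(x) acts on h first, with a minus sign. Hence the recursion
in f replaces h by h ◁ t(x). -/
theorem convolve_shadow_mulRight (hT : M.IsGuinOudom t T) (h x : 𝔤) :
    convolve (LinearMap.mul R _) (M.shadow S T h) T ∘ₗ LinearMap.mulRight R (inc R x) =
      LinearMap.mulRight R (inc R (t x)) ∘ₗ convolve (LinearMap.mul R _) (M.shadow S T h) T -
        convolve (LinearMap.mul R _) (M.shadow S T (M.act h (t x))) T -
        convolve (LinearMap.mul R _) (M.shadow S T h) T ∘ₗ M.der (t x) := by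
  have h₁ : (M.shadow S T h) ∘ₗ LinearMap.mulRight R (inc R x) =
      -(M.shadow S T (M.act h (t x))) - (M.shadow S T h) ∘ₗ M.der (t x) := by
    ext E
    simp [hT.map_mul_inc', antipode_mul, M.envelope.act_mul]
  have h₂ : convolve (LinearMap.mul R _) (M.shadow S T h)
        (LinearMap.mulRight R (inc R (t x)) ∘ₗ T) =
      LinearMap.mulRight R (inc R (t x)) ∘ₗ
        convolve (LinearMap.mul R _) (M.shadow S T h) T := by
    rw [comp_convolve]
    exact convolve_congr fun a b => by simp [mul_assoc]
  rw [convolve_mul_inc, h₁, hT.comp_mulRight, convolve_sub_left, convolve_sub_right,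
    convolve_neg_left, h₂, convolve_der]
  abel

/-- The commutation relation `S (h ◁ 𝒮 (T f₁)) T f₂ = T f s(h) - T (f ◁ s(h))`. -/
theorem convolve_shadow (hS : M.IsGuinOudom s S) (hT : M.IsGuinOudom t T)
    (hst : ∀ x y, ⁅s x, t y⁆ = s (M.act x (t y)) - t (M.act y (s x))) (h : 𝔤) :
    convolve (LinearMap.mul R _) (M.shadow S T h) T =
      LinearMap.mulRight R (inc R (s h)) ∘ₗ T - T ∘ₗ M.der (s h) := by
  ext E
  -- The induction treats all h at once, since its step passes from h to h ◁ t(x).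
  have key := M.induction_der (⨅ h, LinearMap.eqLocus
    (convolve (LinearMap.mul R _) (M.shadow S T h) T)
    (LinearMap.mulRight R (inc R (s h)) ∘ₗ T - T ∘ₗ M.der (s h))) ?_ (fun E x hE hD => ?_) E
  · exact (Submodule.mem_iInf _).1 key h
  · refine (Submodule.mem_iInf _).2 fun h => ?_
    simp [LinearMap.mem_eqLocus, convolve, Algebra.TensorProduct.one_def, hT.map_one,
      M.envelope.act_one, hS.map_inc]
  · refine (Submodule.mem_iInf _).2 fun h => ?_
    have hE := fun h => (Submodule.mem_iInf _).1 hE h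
    have hD := (Submodule.mem_iInf _).1 (hD (t x)) h
    have hC := LinearMap.congr_fun (hT.convolve_shadow_mulRight (S := S) h x) E
    simp only [LinearMap.mem_eqLocus, LinearMap.sub_apply, LinearMap.comp_apply,
      LinearMap.mulRight_apply] at hE hD hC ⊢
    rw [hC, hE, hE, hD, der_mul, map_add, hT.map_mul_inc', hT.map_mul_inc', der_inc,
      hT.map_mul_inc']
    -- The matching relation is solved for s(h ◁ t(x)) and read twice: as elements of U(𝔞) here, and
    -- as derivations of U(𝔤) in `h₂`.
    have h₁ : inc R (s (M.act h (t x))) = inc R (s h) * inc R (t x) - inc R (t x) * inc R (s h) +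
        inc R (t (M.act x (s h))) := by
      rw [← inc_lie, hst, map_sub]; abel
    have h₂ : M.der (s (M.act h (t x))) E = M.der (t x) (M.der (s h) E) -
        M.der (s h) (M.der (t x) E) + M.der (t (M.act x (s h))) E := by
      rw [← der_lie, hst, ← der_add]; congr 1; abel_nf
    rw [h₁, h₂, map_add, map_sub]
    noncomm_ring

/-- This is the image of `convolve_shadow` under the antipode. Reversing the product swaps the two
factors, which cocommutativity absorbs, and the shadow takes values in the image of 𝔞, where the
antipode is -1. -/
theorem convolve_antipode_shadow (hS : M.IsGuinOudom s S) (hT : M.IsGuinOudom t T)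
    (hst : ∀ x y, ⁅s x, t y⁆ = s (M.act x (t y)) - t (M.act y (s x))) (h : 𝔤) :
    convolve (LinearMap.mul R _) (anti T) (M.shadow S T h) =
      LinearMap.mulLeft R (inc R (s h)) ∘ₗ (anti T) + (anti T) ∘ₗ M.der (s h) := by
  have h₁ := congrArg anti (convolve_shadow hS hT hst h)
  have h₂ : anti (convolve (LinearMap.mul R _) (M.shadow S T h) T) =
      -convolve (LinearMap.mul R _) (anti T) (M.shadow S T h) := by
    rw [anti, comp_convolve, ← convolve_neg_right, ← convolve_flip]
    refine convolve_congr fun a b => ?_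
    obtain ⟨y, hy⟩ := M.exists_act_inc h (HopfAlgebra.antipode R (T b))
    simp [antipode_mul, hy, hS.map_inc]
  rw [← neg_inj, ← h₂, h₁]
  ext E
  simp [antipode_mul]
  abel

theorem convolve_mk_anti (hT : M.IsGuinOudom t T) :
    convolve (TensorProduct.mk R _ _) (anti T) (anti T) = Coalgebra.comul ∘ₗ anti T := by
  ext E
  rw [LinearMap.comp_apply, anti_apply, comul_antipode, ← LinearMap.comp_apply Coalgebra.comul,
    ← hT.map_comp_comul]
  simp only [convolve, LinearMap.comp_apply]
  generalize (Coalgebra.comul E : UniversalEnvelopingAlgebra R 𝔤 ⊗[R] _) = z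
  induction z with
  | zero => simp
  | add z w hz hw => simp only [map_add, hz, hw]
  | tmul p q => simp

/-- As 𝒮 ∘ T is a coalgebra morphism, (f₁ h) ◁ 𝒮(T f₂) splits as (f₁ ◁ 𝒮(T f₂))(h ◁ 𝒮(T f₃)). The
other terms come from 𝒮(T(f h)) and combine to a derivative of the twist along t(h). -/
theorem twist_comp_mulRight (hT : M.IsGuinOudom t T) (h : 𝔤) :
    (M.twist T) ∘ₗ LinearMap.mulRight R (inc R h) =
      convolve (LinearMap.mul R _) (M.twist T) (M.envelope.act (inc R h) ∘ₗ anti T) -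
        (M.twist T) ∘ₗ M.der (t h) := by
  have h₁ : convolve M.envelope.act (LinearMap.id ∘ₗ LinearMap.mulRight R (inc R h)) (anti T) =
      convolve (LinearMap.mul R _) (M.twist T) (M.envelope.act (inc R h) ∘ₗ anti T) := by
    have hβ : convolve (LinearMap.mul R _) (M.twist T) (M.envelope.act (inc R h) ∘ₗ anti T) =
        convolve ((LinearMap.mul R _).compl₂ (M.envelope.act (inc R h))) (M.twist T) (anti T) :=
      convolve_congr fun a b => by simp
    rw [hβ, twist, convolve_assoc (ν' := TensorProduct.mk R _ _)
      (μ' := ((TensorProduct.mapBilinear (RingHom.id R) _ _ _ _).flip (M.envelope.act (inc R h)) ∘ₗ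
        M.envelope.act).compr₂ (LinearMap.mul' R _)) (fun x y z => by simp),
      hT.convolve_mk_anti]
    exact convolve_congr fun a b => by simp [M.envelope.mul_act]
  have h₀ : M.twist T = convolve M.envelope.act LinearMap.id (anti T) := rfl
  have h₂ : convolve M.envelope.act LinearMap.id (LinearMap.mulLeft R (inc R (t h)) ∘ₗ anti T) =
      convolve M.envelope.act (LinearMap.id ∘ₗ M.der (t h)) (anti T) :=
    convolve_congr fun a b => by simp [M.envelope.act_mul]
  rw [h₀] at h₁ ⊢
  rw [convolve_mul_inc, h₁, hT.antipode_comp_mulRight, convolve_sub_right, convolve_neg_right, h₂,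
    convolve_der]
  abel

/-- By coassociativity and the module law, the left side is f₁ acted on by 𝒮(T f₂) S(h ◁ 𝒮(T f₃)),
to which `convolve_antipode_shadow` applies. -/
theorem convolve_twist_shadow (hS : M.IsGuinOudom s S) (hT : M.IsGuinOudom t T)
    (hst : ∀ x y, ⁅s x, t y⁆ = s (M.act x (t y)) - t (M.act y (s x))) (h : 𝔤) :
    convolve M.envelope.act (M.twist T) (M.shadow S T h) = (M.twist T) ∘ₗ M.der (s h) := by
  rw [twist, convolve_assoc (μ' := M.envelope.act) (ν' := LinearMap.mul R _)
    (fun x y z => (M.envelope.act_mul x y z).symm), convolve_antipode_shadow hS hT hst,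
    convolve_add_right, convolve_der]
  congr 1
  exact convolve_congr fun a b => by simp [M.envelope.act_mul]

/-- The coproduct of T f₂ in the definition may be replaced by T f₂ ⊗ T f₃, because T is a coalgebra
morphism. -/
theorem hash_eq_convolve (hT : M.IsGuinOudom t T) :
    M.envelope.hash S T = convolve (LinearMap.mul R _) (S ∘ₗ M.twist T) T := by
  have h₁ : convolve (LinearMap.mul R _) (S ∘ₗ M.twist T) T =
      convolve (LinearMap.mul R _ ∘ₗ S)
        (convolve (M.envelope.act.compl₂ (HopfAlgebra.antipode R)) LinearMap.id T) T := by
    have : M.twist T = convolve (M.envelope.act.compl₂ (HopfAlgebra.antipode R)) LinearMap.id T :=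
      convolve_congr fun a b => by simp
    rw [this]
    exact convolve_congr fun a b => by simp
  have h₂ : convolve (TensorProduct.mk R _ _) T T = Coalgebra.comul ∘ₗ T := by
    rw [← hT.map_comp_comul, convolve, ← LinearMap.comp_assoc]
    congr 1
    exact TensorProduct.ext' fun a b => by simp
  rw [h₁, convolve_assoc (ν' := TensorProduct.mk R _ _)
    (μ' := (TensorProduct.mk R _ _).compr₂ (LinearMap.mul' R _ ∘ₗ
      TensorProduct.map (S ∘ₗ TensorProduct.lift M.envelope.act ∘ₗ
        (HopfAlgebra.antipode R).lTensor _) LinearMap.id ∘ₗ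
      (TensorProduct.assoc R _ _ _).symm.toLinearMap)) (fun x y z => by simp), h₂, convolve,
    TensorProduct.lift_mk_compr₂]
  rfl

/-! ### The Guin–Oudom product satisfies the recursion for the sum -/

theorem hash (hS : M.IsGuinOudom s S) (hT : M.IsGuinOudom t T)
    (hst : ∀ x y, ⁅s x, t y⁆ = s (M.act x (t y)) - t (M.act y (s x))) :
    M.IsGuinOudom (s + t) (M.envelope.hash S T) := by
  have h₁ : ∀ h, (S ∘ₗ M.twist T) ∘ₗ LinearMap.mulRight R (inc R h) =
      convolve (LinearMap.mul R _) (S ∘ₗ M.twist T) (M.shadow S T h) -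
        (S ∘ₗ M.twist T) ∘ₗ M.der (s h) - (S ∘ₗ M.twist T) ∘ₗ M.der (t h) := fun h => by
    have : S ∘ₗ convolve (LinearMap.mul R _) (M.twist T) (M.envelope.act (inc R h) ∘ₗ anti T) =
        convolve (LinearMap.mul R _) (S ∘ₗ M.twist T) (M.shadow S T h) -
          S ∘ₗ convolve M.envelope.act (M.twist T) (M.shadow S T h) := by
      rw [comp_convolve, comp_convolve]
      refine convolve_eq_sub fun a b => ?_
      -- The right-hand factor h ◁ 𝒮(T b) lies in 𝔤, so the recursion for S applies to the product.
      obtain ⟨y, hy⟩ := M.exists_act_inc h (HopfAlgebra.antipode R (T b))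
      simp [hy, hS.map_inc, hS.map_mul_inc']
    rw [LinearMap.comp_assoc, hT.twist_comp_mulRight, LinearMap.comp_sub, this,
      convolve_twist_shadow hS hT hst, LinearMap.comp_assoc, LinearMap.comp_assoc]
  have h₂ : ∀ a, convolve (LinearMap.mul R _) (S ∘ₗ M.twist T) (LinearMap.mulRight R a ∘ₗ T) =
      LinearMap.mulRight R a ∘ₗ convolve (LinearMap.mul R _) (S ∘ₗ M.twist T) T := fun a => by
    rw [comp_convolve]
    exact convolve_congr fun a b => by simp [mul_assoc]
  have h₃ : ∀ h, M.envelope.hash S T ∘ₗ LinearMap.mulRight R (inc R h) =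
      LinearMap.mulRight R (inc R (s h)) ∘ₗ M.envelope.hash S T +
        LinearMap.mulRight R (inc R (t h)) ∘ₗ M.envelope.hash S T -
        M.envelope.hash S T ∘ₗ M.der (s h) - M.envelope.hash S T ∘ₗ M.der (t h) := fun h => by
    rw [hT.hash_eq_convolve, convolve_mul_inc, h₁, hT.comp_mulRight, convolve_sub_left,
      convolve_sub_left, convolve_sub_right, convolve_assoc (μ' := LinearMap.mul R _)
      (ν' := LinearMap.mul R _) (fun x y z => mul_assoc x y z), convolve_shadow hS hT hst,
      convolve_sub_right, h₂, h₂, convolve_der, convolve_der]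
    abel
  have one : M.envelope.hash S T 1 = 1 := by
    simp [hT.hash_eq_convolve, twist, convolve, Algebra.TensorProduct.one_def, hS.map_one, hT.map_one,
      M.envelope.act_one, HopfAlgebra.antipode_one]
  have mul : ∀ E h, M.envelope.hash S T (E * inc R h) = M.envelope.hash S T E *
      inc R ((s + t) h) - M.envelope.hash S T (M.envelope.act E (inc R ((s + t) h))) :=
    fun E h => by
      have := LinearMap.congr_fun (h₃ h) E
      simp only [LinearMap.comp_apply, LinearMap.mulRight_apply, LinearMap.sub_apply,
        LinearMap.add_apply] at this
      rw [this, envelope_act_inc, LinearMap.add_apply, der_add, map_add, map_add, mul_add]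
      abel
  refine ⟨one, fun h => ?_, mul⟩
  -- The value on 𝔤 is the case E = 1 of the recursion, where the correction vanishes because 1 ◁ a
  -- = 0.
  simpa [one] using mul 1 h

end IsGuinOudom

end RightLieModule

end

theorem mainTheorem1 {R 𝔤 𝔞 : Type*} [CommRing R] [LieRing 𝔤] [LieAlgebra R 𝔤]
    [LieRing 𝔞] [LieAlgebra R 𝔞] (M : RightLieModule R 𝔤 𝔞) (s t : 𝔤 →ₗ[R] 𝔞)
    (hmatch : M.IsMatchingOLieOperator ![s, t]) :
    ∃ (hs : M.IsOLieOperator s) (ht : M.IsOLieOperator t) (hst : M.IsOLieOperator (s + t)),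
      M.envelope.IsOHopfOperator (M.guinOudom hs) ∧
      M.envelope.IsOHopfOperator (M.guinOudom ht) ∧
      M.envelope.IsOHopfOperator (M.guinOudom hst) ∧
      M.guinOudom hst = M.envelope.hash (M.guinOudom hs) (M.guinOudom ht) ∧
      M.guinOudom hst = M.envelope.hash (M.guinOudom ht) (M.guinOudom hs) := by
  have hs : M.IsOLieOperator s := hmatch.isOLieOperator 0
  have ht : M.IsOLieOperator t := hmatch.isOLieOperator 1
  have h₁ := M.isGuinOudom_guinOudom hs
  have h₂ := M.isGuinOudom_guinOudom ht
  have h₃ := M.isGuinOudom_guinOudom hmatch.add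
  refine ⟨hs, ht, hmatch.add, h₁.isOHopfOperator, h₂.isOHopfOperator, h₃.isOHopfOperator,
    h₃.unique (h₁.hash h₂ (hmatch.matching 0 1 (by decide))), h₃.unique ?_⟩
  rw [add_comm s t]
  exact h₂.hash h₁ (hmatch.matching 1 0 (by decide))
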